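/- All graphs are finite and simple. For a vertex-colored graph $G$ (the coloring need not be proper) a vertex set is *rainbow* if its vertices have pairwise distinct colors. For distinct vertices $x,y$, an *$x$-$y$ rainbow vertex-cut* is a set $S\subseteq V(G)\setminus\{x,y\}$ such that: if $x,y$ are nonadjacent, then $x$ and $y$ lie in different components of $G-S$ and $S$ is rainbow; if $x,y$ are adjacent, then $x$ and $y$ lie in different components of $(G-xy)-S$ and $S\cup\{x\}$ or $S\cup\{y\}$ is rainbow. The *rainbow vertex-disconnection number* $rvd(G)$ is the least number of colors in a vertex-coloring of $G$ for which every two distinct vertices $x,y$ have an $x$-$y$ rainbow vertex-cut. Let $G(n,p)$ be the random graph on $n$ labelled vertices in which each pair is an edge independently with probability $p$. For $p=p(n)$, $G(n,p)$ satisfies a graph property $A$ *almost surely* if $\Pr[G(n,p(n))\text{ satisfies }A]\to 1$ as $n\to\infty$. A function $f(n)$ is called a *sharp threshold function* for $A$ if there are constants $c,C>0$ such that $G(n,cf(n))$ almost surely does not satisfy $A$ (where $0\le cf(n)\le 1$ for all large $n$), and $G(n,p)$ almost surely satisfies $A$ for every $p=p(n)\in[0,1]$ with $p(n)\ge Cf(n)$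 for all sufficiently large $n$. **Theorem.** (1) $\sqrt{\log n/n}$ is a sharp threshold function for the property that $G(n,p)$ is connected with $rvd(G(n,p))=n$. (2) $\sqrt{\log n/n}$ is a sharp threshold function for the property that every two distinct vertices of $G(n,p)$ have at least two common neighbors. (3) The two properties are equivalent: for every graph $G$ of order $n\ge 2$, $rvd(G)=n$ if and only if every two distinct vertices of $G$ have at least two common neighbors, and in that case $G$ is connected. -/

import Mathlib

namespace RainbowVertexDisconnection

/-- `x` and `y` are vertices outside `S` lying in different components of `G - S`. -/
def Separates {V : Type*} (G : SimpleGraph V) (S : Set V) (x y : V) : Prop :=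
  ∃ (hx : x ∈ Sᶜ) (hy : y ∈ Sᶜ), ¬ (G.induce Sᶜ).Reachable ⟨x, hx⟩ ⟨y, hy⟩

/-- `S` is an `x`-`y` vertex-cut of `G`: it separates `x` from `y` in `G` if they are nonadjacent,
and in `G - xy` if they are adjacent. -/
def IsVertexCut {V : Type*} (G : SimpleGraph V) (S : Set V) (x y : V) : Prop :=
  (¬ G.Adj x y → Separates G S x y) ∧ (G.Adj x y → Separates (G.deleteEdges {s(x, y)}) S x y)

/-- `S` is rainbow under the vertex-coloring `c`: no two vertices of `S` have the same color. -/
def IsRainbow {V κ : Type*} (c : V → κ) (S : Set V) : Prop := Set.InjOn c S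

/-- `S` is an `x`-`y` rainbow vertex-cut of `G` under the vertex-coloring `c`. -/
def IsRainbowVertexCut {V κ : Type*} (G : SimpleGraph V) (c : V → κ) (S : Set V) (x y : V) : Prop :=
  IsVertexCut G S x y ∧ (¬ G.Adj x y → IsRainbow c S) ∧
    (G.Adj x y → IsRainbow c (insert x S) ∨ IsRainbow c (insert y S))

/-- `c` is a rainbow vertex-disconnection coloring of `G` (not necessarily a proper coloring). -/
def IsRvdColoring {V κ : Type*} (G : SimpleGraph V) (c : V → κ) : Prop :=
  ∀ x y : V, x ≠ y → ∃ S : Set V, IsRainbowVertexCut G c S x y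

/-- The rainbow vertex-disconnection number: the least number of colors of a rainbow
vertex-disconnection coloring. -/
noncomputable def rvd {V : Type*} (G : SimpleGraph V) : ℕ :=
  sInf {k : ℕ | ∃ c : V → Fin k, IsRvdColoring G c}

/-- Coloring all vertices differently is a rainbow vertex-disconnection coloring, so for a finite
graph the infimum defining `rvd` is taken over a nonempty set. -/
theorem isRvdColoring_of_injective {V κ : Type*} (G : SimpleGraph V) (c : V → κ)
    (hc : Function.Injective c) : IsRvdColoring G c := by
  intro x y hxy
  have key : ∀ H : SimpleGraph V, ¬ H.Adj x y → Separates H ({x, y}ᶜ : Set V) x y := by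
    intro H hH
    refine ⟨by simp, by simp, ?_⟩
    rintro ⟨w⟩
    cases w with
    | nil => exact hxy rfl
    | @cons _ v _ h p =>
      obtain ⟨v, hv⟩ := v
      have h' : H.Adj x v := h
      simp only [compl_compl, Set.mem_insert_iff, Set.mem_singleton_iff] at hv
      rcases hv with rfl | rfl
      · exact H.loopless.irrefl _ h'
      · exact hH h'
  exact ⟨({x, y}ᶜ : Set V), ⟨key G, fun _ => key _ (by simp)⟩, fun _ => hc.injOn,
    fun _ => Or.inl hc.injOn⟩

theorem rvd_le {n : ℕ} (G : SimpleGraph (Fin n)) : rvd G ≤ n :=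
  Nat.sInf_le ⟨id, isRvdColoring_of_injective G id Function.injective_id⟩

/-- Any two vertices of `G` have at least two common neighbors. -/
def TwoCommonNeighbors {V : Type*} (G : SimpleGraph V) : Prop :=
  ∀ x y : V, x ≠ y → 2 ≤ (G.commonNeighbors x y).ncard

/-- The binomial random graph `G(n, p n)` satisfies the property `A` almost surely:
the probability tends to `1` as `n` tends to infinity. -/
def AlmostSurely (p : ℕ → unitInterval) (A : ∀ n : ℕ, SimpleGraph (Fin n) → Prop) : Prop :=
  Filter.Tendsto (fun n : ℕ => SimpleGraph.binomialRandom (Fin n) (p n) {G | A n G})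
    Filter.atTop (nhds 1)

/-- `f` is a sharp threshold function for the graph property `A`: for some constants `c, C > 0`,
`G(n, c f(n))` almost surely does not satisfy `A` (where `c f(n)` is a probability for all large
`n`), and `G(n, p)` almost surely satisfies `A` for every `p = p(n)` with `p(n) ≥ C f(n)` for all
large `n`. The finitely many small `n` are exempted, as `C f(n)` may exceed `1` there. -/
def IsSharpThreshold (f : ℕ → ℝ) (A : ∀ n : ℕ, SimpleGraph (Fin n) → Prop) : Prop :=
  ∃ c C : ℝ, 0 < c ∧ 0 < C ∧
    (∃ p : ℕ → unitInterval, (∀ᶠ n in Filter.atTop, (p n : ℝ) = c * f n) ∧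
      AlmostSurely p (fun n G => ¬ A n G)) ∧
    (∀ p : ℕ → unitInterval, (∀ᶠ n in Filter.atTop, C * f n ≤ (p n : ℝ)) → AlmostSurely p A)

end RainbowVertexDisconnection

namespace RainbowVertexDisconnection

/-! ### Cuts, common neighbors and colorings. -/

section Deterministic

variable {V : Type*} {G : SimpleGraph V}

/-! Every cut between two vertices contains all their common neighbors. Suppose any two vertices
have two common neighbors and x, y share a color. Two common neighbors u, v of x, y then have both x
and y in each of their cuts, so no u-v cut is rainbow; hence all colors differ
(`IsRvdColoring.injective`). Conversely, if x and y have at most one common neighbor, they can share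
a color (`isRvdColoring_of_commonNeighbors_subsingleton`), which saves a color. This is
`rvd_eq_iff`, and it reduces both thresholds to one.

Above the threshold, a union bound over a pair and its only possible common neighbor suffices
(`measureReal_not_twoCommonNeighbors_le`). Below it, fix x and reveal its neighborhood N. Each
vertex outside N other than x must have a neighbor in N, and these events are independent of each
other and of N. Either N is unusually large, which an exponential Markov bound makes unlikely, or N
is too small to dominate about n vertices (`measureReal_twoCommonNeighbors_le`). -/

theorem Separates.mem_of_adj {S : Set V} {x y z : V} (h : Separates G S x y) (hxz : G.Adj x z)
    (hzy : G.Adj z y) : z ∈ S := by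
  obtain ⟨hx, hy, hS⟩ := h
  by_contra hz
  have h₁ : (G.induce Sᶜ).Adj ⟨x, hx⟩ ⟨z, hz⟩ := hxz
  have h₂ : (G.induce Sᶜ).Adj ⟨z, hz⟩ ⟨y, hy⟩ := hzy
  exact hS (h₁.reachable.trans h₂.reachable)

theorem IsVertexCut.commonNeighbors_subset {S : Set V} {x y : V} (h : IsVertexCut G S x y) :
    G.commonNeighbors x y ⊆ S := by
  rintro z ⟨hxz, hyz⟩
  rw [SimpleGraph.mem_neighborSet] at hxz hyz
  by_cases hxy : G.Adj x y
  · refine (h.2 hxy).mem_of_adj (z := z) ?_ ?_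
    · simp [SimpleGraph.deleteEdges_adj, hxz, hyz.ne', hxz.ne']
    · simp [SimpleGraph.deleteEdges_adj, hyz.symm, hyz.ne', hxz.ne']
  · exact (h.1 hxy).mem_of_adj hxz hyz.symm

theorem IsRainbowVertexCut.isRainbow {κ : Type*} {c : V → κ} {S : Set V} {x y : V}
    (h : IsRainbowVertexCut G c S x y) : IsRainbow c S := by
  by_cases hxy : G.Adj x y
  · rcases h.2.2 hxy with h | h <;> exact h.mono (Set.subset_insert _ _)
  · exact h.2.1 hxy

theorem IsRvdColoring.injective {κ : Type*} {c : V → κ} (hc : IsRvdColoring G c)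
    (hG : TwoCommonNeighbors G) : Function.Injective c := by
  intro x y hxy
  by_contra hne
  obtain ⟨u, hu, v, hv, huv⟩ := (Set.one_lt_ncard_iff_nontrivial_and_finite.1 (hG x y hne)).1
  obtain ⟨S, hS⟩ := hc u v huv
  exact hne (hS.isRainbow (hS.1.commonNeighbors_subset ⟨hu.1.symm, hv.1.symm⟩)
    (hS.1.commonNeighbors_subset ⟨hu.2.symm, hv.2.symm⟩) hxy)

theorem separates_of_forall_not_adj {S : Set V} {x y : V} (hxy : x ≠ y) (hx : x ∉ S) (hy : y ∉ S)
    (h : ∀ z ∉ S, ¬ G.Adj x z) : Separates G S x y := by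
  refine ⟨hx, hy, ?_⟩
  rintro ⟨w⟩
  cases w with
  | nil => exact hxy rfl
  | @cons _ v _ h' p => exact h v.1 v.2 h'

theorem Separates.symm {S : Set V} {x y : V} (h : Separates G S x y) : Separates G S y x :=
  ⟨h.2.1, h.1, fun h' => h.2.2 h'.symm⟩

theorem isVertexCut_compl_pair {u v : V} (huv : u ≠ v) : IsVertexCut G {u, v}ᶜ u v := by
  constructor
  · intro h
    refine separates_of_forall_not_adj huv (by simp) (by simp) fun z hz => ?_
    simp only [Set.mem_compl_iff, not_not, Set.mem_insert_iff, Set.mem_singleton_iff] at hz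
    rcases hz with rfl | rfl
    exacts [G.irrefl, h]
  · intro h
    refine separates_of_forall_not_adj huv (by simp) (by simp) fun z hz => ?_
    simp only [Set.mem_compl_iff, not_not, Set.mem_insert_iff, Set.mem_singleton_iff] at hz
    rcases hz with rfl | rfl <;> simp

/-- Only u, v, x survive, and the edge uv, if present, is discounted; the only possible connection
is the path u, x, v. -/
theorem isVertexCut_compl_triple {u v x : V} (huv : u ≠ v) (hux : u ≠ x) (hvx : v ≠ x)
    (h : x ∉ G.commonNeighbors u v) : IsVertexCut G {u, v, x}ᶜ u v := by
  -- Stated for subgraphs so that it serves both G and G with the edge uv deleted.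
  have key : ∀ H : SimpleGraph V, H ≤ G → ¬ H.Adj u v → Separates H {u, v, x}ᶜ u v := by
    intro H hH huvH
    by_cases hu : H.Adj u x
    · have hv : ¬ H.Adj v x := fun hv => h ⟨hH hu, hH hv⟩
      refine (separates_of_forall_not_adj huv.symm (by simp) (by simp) fun z hz => ?_).symm
      simp only [Set.mem_compl_iff, not_not, Set.mem_insert_iff, Set.mem_singleton_iff] at hz
      rcases hz with rfl | rfl | rfl
      exacts [fun h => huvH h.symm, H.irrefl, hv]
    · refine separates_of_forall_not_adj huv (by simp) (by simp) fun z hz => ?_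
      simp only [Set.mem_compl_iff, not_not, Set.mem_insert_iff, Set.mem_singleton_iff] at hz
      rcases hz with rfl | rfl | rfl
      exacts [H.irrefl, huvH, hu]
  exact ⟨key G le_rfl, fun _ => key _ (SimpleGraph.deleteEdges_le _) (by simp)⟩

/-- Identifying the colors of two vertices with at most one common neighbor leaves a rainbow
vertex-disconnection coloring. -/
theorem isRvdColoring_of_commonNeighbors_subsingleton {κ : Type*} {c : V → κ} {x y : V}
    (hG : (G.commonNeighbors x y).Subsingleton)
    (hx : Set.InjOn c {x}ᶜ) (hy : Set.InjOn c {y}ᶜ) : IsRvdColoring G c := by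
  intro u v huv
  by_cases h : (x ≠ u ∧ x ≠ v) ∧ (y ≠ u ∧ y ≠ v)
  · obtain ⟨⟨hxu, hxv⟩, hyu, hyv⟩ := h
    by_cases hcx : x ∈ G.commonNeighbors u v
    · have hcy : y ∉ G.commonNeighbors u v := fun hcy =>
        huv (hG ⟨hcx.1.symm, hcy.1.symm⟩ ⟨hcx.2.symm, hcy.2.symm⟩)
      refine ⟨{u, v, y}ᶜ, isVertexCut_compl_triple huv hyu.symm hyv.symm hcy,
        fun _ => hy.mono ?_, fun _ => .inl (hy.mono ?_)⟩ <;> intro z hz <;> grind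
    · refine ⟨{u, v, x}ᶜ, isVertexCut_compl_triple huv hxu.symm hxv.symm hcx,
        fun _ => hx.mono ?_, fun _ => .inl (hx.mono ?_)⟩ <;> intro z hz <;> grind
  · refine ⟨{u, v}ᶜ, isVertexCut_compl_pair huv, fun _ => ?_, fun _ => ?_⟩
    · have : x = u ∨ x = v ∨ y = u ∨ y = v := by tauto
      rcases this with rfl | rfl | rfl | rfl
      · exact hx.mono (by intro z hz; grind)
      · exact hx.mono (by intro z hz; grind)
      · exact hy.mono (by intro z hz; grind)
      · exact hy.mono (by intro z hz; grind)
    -- One endpoint is x or y; adding the other endpoint to the cut keeps it away from that vertex.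
    · have : x = u ∨ x = v ∨ y = u ∨ y = v := by tauto
      rcases this with rfl | rfl | rfl | rfl
      · exact .inr (hx.mono (by intro z hz; grind))
      · exact .inl (hx.mono (by intro z hz; grind))
      · exact .inr (hy.mono (by intro z hz; grind))
      · exact .inl (hy.mono (by intro z hz; grind))

theorem TwoCommonNeighbors.connected [Nonempty V] (hG : TwoCommonNeighbors G) : G.Connected := by
  refine ⟨fun x y => ?_⟩
  rcases eq_or_ne x y with rfl | hxy
  · rfl
  obtain ⟨z, hz⟩ := Set.nonempty_of_ncard_ne_zero (by have := hG x y hxy; omega :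
    (G.commonNeighbors x y).ncard ≠ 0)
  exact hz.1.reachable.trans hz.2.symm.reachable

/-- The rainbow vertex-disconnection number is the order of the graph exactly if any two vertices
have two common neighbors. -/
theorem rvd_eq_iff {n : ℕ} (hn : 2 ≤ n) (G : SimpleGraph (Fin n)) :
    rvd G = n ↔ TwoCommonNeighbors G := by
  constructor
  · intro h x y hxy
    by_contra! hlt
    have hs : (G.commonNeighbors x y).Subsingleton := fun a ha b hb =>
      (Set.ncard_le_one_iff (Set.toFinite _)).1 (Nat.le_of_lt_succ hlt) ha hb
    have e : {z : Fin n // z ≠ y} ≃ Fin (n - 1) := Fintype.equivFinOfCardEq (by simp)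
    -- The vertex y takes the color of x; all other colors are distinct.
    let c : Fin n → Fin (n - 1) := fun z => if hz : z = y then e ⟨x, hxy⟩ else e ⟨z, hz⟩
    have hcy : Set.InjOn c {y}ᶜ := by
      intro a ha b hb hab
      have ha : a ≠ y := ha
      have hb : b ≠ y := hb
      simpa [c, ha, hb] using hab
    have hcx : Set.InjOn c {x}ᶜ := by
      intro a ha b hb hab
      have ha : a ≠ x := ha
      have hb : b ≠ x := hb
      by_cases ha' : a = y <;> by_cases hb' : b = y
      · exact ha'.trans hb'.symm
      · simp [c, ha', hb'] at hab; exact absurd hab.symm hb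
      · simp [c, ha', hb'] at hab; exact absurd hab ha
      · simpa [c, ha', hb'] using hab
    have : rvd G ≤ n - 1 :=
      Nat.sInf_le ⟨c, isRvdColoring_of_commonNeighbors_subsingleton hs hcx hcy⟩
    omega
  · intro hG
    refine (rvd_le G).antisymm (le_csInf ⟨n, id, isRvdColoring_of_injective G id
      Function.injective_id⟩ ?_)
    rintro k ⟨c, hc⟩
    simpa using Fintype.card_le_of_injective c (hc.injective hG)

end Deterministic

open MeasureTheory ProbabilityTheory unitInterval

/-! ### Independence of events determined by disjoint sets of pairs. -/

section Independence

variable {V : Type*}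

/-- The event `A` depends only on the pairs in `F`. -/
def DeterminedOn (F : Set (Sym2 V)) (A : Set (SimpleGraph V)) : Prop :=
  ∀ G H : SimpleGraph V, (∀ e ∈ F, e ∈ G.edgeSet ↔ e ∈ H.edgeSet) → G ∈ A → H ∈ A

theorem DeterminedOn.biInter {ι : Type*} {J : Finset ι} {F : ι → Set (Sym2 V)}
    {A : ι → Set (SimpleGraph V)} (h : ∀ i ∈ J, DeterminedOn (F i) (A i)) :
    DeterminedOn (⋃ i ∈ J, F i) (⋂ i ∈ J, A i) := by
  intro G H hGH hG
  simp only [Set.mem_iInter] at hG ⊢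
  exact fun i hi => h i hi G H (fun e he => hGH e (Set.mem_biUnion hi he)) (hG i hi)

theorem DeterminedOn.mono {F F' : Set (Sym2 V)} {A : Set (SimpleGraph V)} (h : DeterminedOn F A)
    (hF : F ⊆ F') : DeterminedOn F' A :=
  fun G H hGH => h G H fun e he => hGH e (hF he)

theorem DeterminedOn.compl {F : Set (Sym2 V)} {A : Set (SimpleGraph V)} (h : DeterminedOn F A) :
    DeterminedOn F Aᶜ :=
  fun G H hGH hG hH => hG (h H G (fun e he => (hGH e he).symm) hH)

theorem DeterminedOn.inter {F : Set (Sym2 V)} {A B : Set (SimpleGraph V)} (hA : DeterminedOn F A)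
    (hB : DeterminedOn F B) : DeterminedOn F (A ∩ B) :=
  fun G H hGH hG => ⟨hA G H hGH hG.1, hB G H hGH hG.2⟩

theorem determinedOn_adj (x y : V) : DeterminedOn {s(x, y)} {G | G.Adj x y} :=
  fun _ _ hGH hG => (hGH s(x, y) rfl).1 hG

variable [Finite V]

instance : DiscreteMeasurableSpace (SimpleGraph V) := by
  have : MeasurableSingletonClass (SimpleGraph V) := ⟨fun G => by
    have h := SimpleGraph.measurable_edgeSet (V := V) (measurableSet_singleton G.edgeSet)
    convert h
    ext H
    simp⟩
  infer_instance

theorem measurable_fromEdgeSet_ofPred :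
    Measurable fun q : Sym2 V → Prop => SimpleGraph.fromEdgeSet {i | q i} :=
  Measurable.of_discrete

theorem binomialRandom_eq_map_infinitePi (p : I) :
    SimpleGraph.binomialRandom V p =
      (Measure.infinitePi fun e : Sym2 V =>
        toNNReal p • Measure.dirac (e ∈ Sym2.diagSetᶜ) +
          toNNReal (σ p) • Measure.dirac False).map
        fun q => SimpleGraph.fromEdgeSet {i | q i} := by
  rw [SimpleGraph.binomialRandom_eq_map, setBernoulli_eq_map,
    Measure.map_map (by fun_prop) (by fun_prop)]
  rfl

/-- The edge indicators of a binomial random graph are independent. -/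
theorem iIndepFun_mem_edgeSet (p : I) :
    iIndepFun (fun (e : Sym2 V) (G : SimpleGraph V) => e ∈ G.edgeSet)
      (SimpleGraph.binomialRandom V p) := by
  have key := iIndepFun_infinitePi
    (P := fun e : Sym2 V => toNNReal p • Measure.dirac (e ∈ Sym2.diagSetᶜ) +
      toNNReal (σ p) • Measure.dirac False)
    (X := fun e q => q ∧ ¬ e.IsDiag) (fun e => measurable_from_top)
  rw [iIndepFun_iff_measure_inter_preimage_eq_mul] at key ⊢
  intro S sets hS
  -- Membership of e in the edge set depends on coordinate e alone, since `fromEdgeSet` only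
  -- discards the diagonal.
  have h (e : Sym2 V) : (fun q : Sym2 V → Prop => SimpleGraph.fromEdgeSet {i | q i}) ⁻¹'
      ((fun G : SimpleGraph V => e ∈ G.edgeSet) ⁻¹' sets e) =
      (fun q : Sym2 V → Prop => q e ∧ ¬ e.IsDiag) ⁻¹' sets e := by
    ext q
    simp
  rw [binomialRandom_eq_map_infinitePi,
    Measure.map_apply measurable_fromEdgeSet_ofPred MeasurableSet.of_discrete]
  simp only [Set.preimage_iInter, h]
  rw [key S hS]
  refine Finset.prod_congr rfl fun e _ => ?_
  rw [Measure.map_apply measurable_fromEdgeSet_ofPred MeasurableSet.of_discrete, h]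

/-- Each event is a preimage under the restriction of the edge indicators to its set of pairs, and
disjoint blocks of independent variables are independent. -/
theorem measureReal_inter_of_determinedOn (p : I) {F F' : Set (Sym2 V)} (hF : Disjoint F F')
    {A B : Set (SimpleGraph V)} (hA : DeterminedOn F A) (hB : DeterminedOn F' B) :
    (SimpleGraph.binomialRandom V p).real (A ∩ B) =
      (SimpleGraph.binomialRandom V p).real A * (SimpleGraph.binomialRandom V p).real B := by
  classical
  have eq_preimage {F : Set (Sym2 V)} {A : Set (SimpleGraph V)} (hA : DeterminedOn F A) :
      A = (fun (G : SimpleGraph V) (e : (Set.toFinite F).toFinset) => (e : Sym2 V) ∈ G.edgeSet) ⁻¹'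
        ((fun (G : SimpleGraph V) (e : (Set.toFinite F).toFinset) =>
          (e : Sym2 V) ∈ G.edgeSet) '' A) := by
    refine (Set.subset_preimage_image _ _).antisymm ?_
    rintro H ⟨G, hG, hGH⟩
    exact hA G H (fun e he => iff_of_eq (congrFun hGH ⟨e, by simpa using he⟩)) hG
  have hind := (iIndepFun_mem_edgeSet (V := V) p).indepFun_finset (Set.toFinite F).toFinset
    (Set.toFinite F').toFinset (by simpa using hF) (fun e => Measurable.of_discrete)
  have := hind.measure_inter_preimage_eq_mul
    ((fun (G : SimpleGraph V) (e : (Set.toFinite F).toFinset) => (e : Sym2 V) ∈ G.edgeSet) '' A)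
    ((fun (G : SimpleGraph V) (e : (Set.toFinite F').toFinset) => (e : Sym2 V) ∈ G.edgeSet) '' B)
    MeasurableSet.of_discrete MeasurableSet.of_discrete
  rw [← eq_preimage hA, ← eq_preimage hB] at this
  simp [measureReal_def, this]

theorem measureReal_biInter_of_determinedOn (p : I) {ι : Type*} (J : Finset ι)
    {F : ι → Set (Sym2 V)} {A : ι → Set (SimpleGraph V)}
    (hF : (J : Set ι).PairwiseDisjoint F) (hA : ∀ i ∈ J, DeterminedOn (F i) (A i)) :
    (SimpleGraph.binomialRandom V p).real (⋂ i ∈ J, A i) =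
      ∏ i ∈ J, (SimpleGraph.binomialRandom V p).real (A i) := by
  classical
  induction J using Finset.induction_on with
  | empty => simp
  | insert i J hi ih =>
    have hA' : ∀ j ∈ J, DeterminedOn (F j) (A j) := fun j hj => hA j (Finset.mem_insert_of_mem hj)
    have hFJ : Disjoint (F i) (⋃ j ∈ J, F j) := Set.disjoint_iUnion₂_right.2 fun j hj =>
      hF (by simp) (by simp [hj]) (by rintro rfl; exact hi hj)
    rw [Finset.set_biInter_insert, Finset.prod_insert hi, ← ih (hF.subset (by simp)) hA',
      measureReal_inter_of_determinedOn p hFJ (hA i (by simp)) (.biInter hA')]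

theorem measureReal_adj (p : I) {x y : V} (h : x ≠ y) :
    (SimpleGraph.binomialRandom V p).real {G | G.Adj x y} = p := by
  have hpre : (fun q : Sym2 V → Prop => SimpleGraph.fromEdgeSet {i | q i}) ⁻¹' {G | G.Adj x y} =
      (fun q : Sym2 V → Prop => q s(x, y)) ⁻¹' {True} := by
    ext q
    simp [h]
  rw [binomialRandom_eq_map_infinitePi, measureReal_def,
    Measure.map_apply measurable_fromEdgeSet_ofPred MeasurableSet.of_discrete, hpre,
    ← Measure.map_apply (measurable_pi_apply _) MeasurableSet.of_discrete,
    Measure.infinitePi_map_eval]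
  simp [h]

theorem measureReal_not_adj (p : I) {x y : V} (h : x ≠ y) :
    (SimpleGraph.binomialRandom V p).real {G | ¬ G.Adj x y} = 1 - p := by
  rw [← measureReal_adj p h, ← probReal_compl_eq_one_sub MeasurableSet.of_discrete]
  rfl

end Independence

/-! ### Probability bounds for fixed order. -/

section FiniteBounds

variable {V : Type*}

/-- For distinct z in T the pairs {xz, yz} are disjoint, so the events multiply. -/
theorem measureReal_forall_not_adj_and_adj [Finite V] (p : I) {x y : V} (hxy : x ≠ y) {T : Finset V}
    (hx : x ∉ T) (hy : y ∉ T) :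
    (SimpleGraph.binomialRandom V p).real {G | ∀ z ∈ T, ¬ (G.Adj x z ∧ G.Adj y z)} =
      (1 - (p : ℝ) ^ 2) ^ T.card := by
  have hset : {G : SimpleGraph V | ∀ z ∈ T, ¬ (G.Adj x z ∧ G.Adj y z)} =
      ⋂ z ∈ T, ({G | G.Adj x z} ∩ {G | G.Adj y z})ᶜ := by
    ext G
    simp
  rw [hset, measureReal_biInter_of_determinedOn p T (F := fun z => {s(x, z), s(y, z)})]
  · refine Finset.prod_eq_pow_card fun z hz => ?_
    have hxz : x ≠ z := by rintro rfl; exact hx hz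
    have hyz : y ≠ z := by rintro rfl; exact hy hz
    rw [probReal_compl_eq_one_sub MeasurableSet.of_discrete, measureReal_inter_of_determinedOn p
      (by simp [hxy, hxz]) (determinedOn_adj x z) (determinedOn_adj y z),
      measureReal_adj p hxz, measureReal_adj p hyz, sq]
  · intro z hz w hw hzw
    have hxz : x ≠ z := by rintro rfl; exact hx hz
    have hyz : y ≠ z := by rintro rfl; exact hy hz
    have hxw : x ≠ w := by rintro rfl; exact hx hw
    have hyw : y ≠ w := by rintro rfl; exact hy hw
    simp [Function.onFun, hzw.symm, hxz, hyz, hxw.symm, hyw.symm, hxy, hxy.symm]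
  · exact fun z _ => (((determinedOn_adj x z).mono (by simp)).inter
      ((determinedOn_adj y z).mono (by simp))).compl

theorem measureReal_not_twoCommonNeighbors_le [Fintype V] (p : I) (hV : 3 ≤ Fintype.card V) :
    (SimpleGraph.binomialRandom V p).real {G | ¬ TwoCommonNeighbors G} ≤
      (Fintype.card V : ℝ) ^ 3 * (1 - (p : ℝ) ^ 2) ^ (Fintype.card V - 3) := by
  classical
  have hp : (0 : ℝ) ≤ 1 - (p : ℝ) ^ 2 := by nlinarith [p.2.1, p.2.2]
  let B : V × V × V → Set (SimpleGraph V) := fun t =>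
    {G | (t.1 ≠ t.2.1 ∧ t.1 ≠ t.2.2 ∧ t.2.1 ≠ t.2.2) ∧
      ∀ z ∈ ({t.1, t.2.1, t.2.2} : Finset V)ᶜ, ¬ (G.Adj t.1 z ∧ G.Adj t.2.1 z)}
  have hsub : {G : SimpleGraph V | ¬ TwoCommonNeighbors G} ⊆ ⋃ t ∈ Finset.univ, B t := by
    intro G hG
    simp only [TwoCommonNeighbors, Set.mem_ofPred_eq, not_forall, not_le] at hG
    obtain ⟨x, y, hxy, hlt⟩ := hG
    -- Here w is the only common neighbor, or any third vertex if there is none; the latter needs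
    -- three vertices.
    obtain ⟨w, hxw, hyw, hw⟩ : ∃ w, x ≠ w ∧ y ≠ w ∧ ∀ z ∈ G.commonNeighbors x y, z = w := by
      rcases (G.commonNeighbors x y).eq_empty_or_nonempty with he | ⟨w, hw⟩
      · obtain ⟨w, hw⟩ := Finset.exists_mem_notMem_of_card_lt_card (s := {x, y})
          (t := (Finset.univ : Finset V)) (by
            rw [Finset.card_pair hxy, Finset.card_univ]
            omega)
        simp only [Finset.mem_univ, Finset.mem_insert, Finset.mem_singleton, not_or,
          true_and] at hw
        exact ⟨w, Ne.symm hw.1, Ne.symm hw.2, by simp [he]⟩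
      · exact ⟨w, hw.1.ne, hw.2.ne, fun z hz =>
          (Set.ncard_le_one_iff (Set.toFinite _)).1 (Nat.le_of_lt_succ hlt) hz hw⟩
    refine Set.mem_biUnion (x := (x, y, w)) (by simp) ⟨⟨hxy, hxw, hyw⟩, fun z hz hxyz => ?_⟩
    simp only [Finset.mem_compl, Finset.mem_insert, Finset.mem_singleton, not_or] at hz
    exact hz.2.2 (hw z hxyz)
  have hB (t : V × V × V) : (SimpleGraph.binomialRandom V p).real (B t) ≤
      (1 - (p : ℝ) ^ 2) ^ (Fintype.card V - 3) := by
    obtain ⟨x, y, w⟩ := t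
    by_cases h : x ≠ y ∧ x ≠ w ∧ y ≠ w
    · refine (measureReal_mono (fun G hG => hG.2)).trans_eq
        ((measureReal_forall_not_adj_and_adj p h.1 (by simp) (by simp)).trans ?_)
      rw [Finset.card_compl, Finset.card_eq_three.2 ⟨x, y, w, h.1, h.2.1, h.2.2, rfl⟩]
    · have : B (x, y, w) = ∅ := Set.eq_empty_of_forall_notMem fun G hG => h hG.1
      rw [this, measureReal_empty]
      positivity
  calc _ ≤ (SimpleGraph.binomialRandom V p).real (⋃ t ∈ Finset.univ, B t) :=
      measureReal_mono hsub (measure_ne_top _ _)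
    _ ≤ ∑ t, (SimpleGraph.binomialRandom V p).real (B t) := measureReal_biUnion_finset_le _ _
    _ ≤ ∑ _t : V × V × V, (1 - (p : ℝ) ^ 2) ^ (Fintype.card V - 3) :=
      Finset.sum_le_sum fun t _ => hB t
    _ = _ := by
      simp only [Finset.sum_const, Finset.card_univ, Fintype.card_prod, nsmul_eq_mul]
      push_cast
      ring

/-- The event that `N` is the neighborhood of `x`. -/
def neighborhoodEvent [Fintype V] [DecidableEq V] (x : V) (N : Finset V) : Set (SimpleGraph V) :=
  ⋂ z ∈ Finset.univ.erase x, {G | G.Adj x z ↔ z ∈ N}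

/-- The event that every vertex outside `N` other than `x` has a neighbor in `N`. -/
def dominatingEvent [Fintype V] [DecidableEq V] (x : V) (N : Finset V) : Set (SimpleGraph V) :=
  ⋂ y ∈ Finset.univ.erase x \ N, (⋂ z ∈ N, {G | G.Adj y z}ᶜ)ᶜ

theorem determinedOn_adj_iff (x z : V) (N : Finset V) :
    DeterminedOn {s(x, z)} {G | G.Adj x z ↔ z ∈ N} :=
  fun _ _ hGH hG => (hGH s(x, z) rfl).symm.trans hG

theorem measureReal_neighborhoodEvent [Fintype V] [DecidableEq V] (p : I) {x : V} {N : Finset V}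
    (hN : N ⊆ Finset.univ.erase x) :
    (SimpleGraph.binomialRandom V p).real (neighborhoodEvent x N) =
      (p : ℝ) ^ N.card * (1 - p) ^ ((Finset.univ.erase x).card - N.card) := by
  rw [neighborhoodEvent, measureReal_biInter_of_determinedOn p _ (F := fun z => {s(x, z)})
    _ fun z _ => determinedOn_adj_iff x z N]
  · rw [← Finset.card_sdiff_of_subset hN, ← Finset.prod_sdiff hN, mul_comm]
    congr 1
    · refine Finset.prod_eq_pow_card fun z hz => ?_
      have hxz : x ≠ z := (Finset.ne_of_mem_erase (hN hz)).symm
      simpa [hz] using measureReal_adj p hxz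
    · refine Finset.prod_eq_pow_card fun z hz => ?_
      rw [Finset.mem_sdiff] at hz
      have hxz : x ≠ z := (Finset.ne_of_mem_erase hz.1).symm
      simpa [hz.2] using measureReal_not_adj p hxz
  · intro z hz w hw hzw
    have hxz : x ≠ z := (Finset.ne_of_mem_erase hz).symm
    simp [Function.onFun, hzw, hxz.symm]

theorem determinedOn_iInter_not_adj (y : V) (N : Finset V) :
    DeterminedOn ((fun z => s(y, z)) '' N) (⋂ z ∈ N, {G : SimpleGraph V | G.Adj y z}ᶜ) :=
  (DeterminedOn.biInter fun z _ => (determinedOn_adj y z).compl).mono (by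
    simp only [Set.iUnion_subset_iff, Set.singleton_subset_iff]
    exact fun z hz => ⟨z, hz, rfl⟩)

theorem measureReal_iInter_not_adj [Finite V] (p : I) {y : V} {N : Finset V} (hy : y ∉ N) :
    (SimpleGraph.binomialRandom V p).real (⋂ z ∈ N, {G : SimpleGraph V | G.Adj y z}ᶜ) =
      (1 - (p : ℝ)) ^ N.card := by
  rw [measureReal_biInter_of_determinedOn p _ (F := fun z => {s(y, z)})
    _ fun z _ => (determinedOn_adj y z).compl]
  · exact Finset.prod_eq_pow_card fun z hz =>
      measureReal_not_adj p (by rintro rfl; exact hy hz)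
  · intro z hz w hw hzw
    have hyz : y ≠ z := by rintro rfl; exact hy hz
    simp [Function.onFun, hzw, hyz.symm]

/-- Stars from different centers y outside N to N share no pair. -/
theorem measureReal_dominatingEvent [Fintype V] [DecidableEq V] (p : I) (x : V) (N : Finset V) :
    (SimpleGraph.binomialRandom V p).real (dominatingEvent x N) =
      (1 - (1 - (p : ℝ)) ^ N.card) ^ (Finset.univ.erase x \ N).card := by
  rw [dominatingEvent, measureReal_biInter_of_determinedOn p _ _
    fun y _ => (determinedOn_iInter_not_adj y N).compl]
  · refine Finset.prod_eq_pow_card fun y hy => ?_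
    rw [probReal_compl_eq_one_sub MeasurableSet.of_discrete,
      measureReal_iInter_not_adj p (Finset.mem_sdiff.1 hy).2]
  · intro y hy w hw hyw
    have hy : y ∉ N := (Finset.mem_sdiff.1 hy).2
    rw [Function.onFun, Set.disjoint_left]
    rintro _ ⟨z, hz, rfl⟩ ⟨z', hz', he⟩
    rcases Sym2.eq_iff.1 he with ⟨h, -⟩ | ⟨-, h⟩
    · exact hyw h.symm
    · exact hy (h ▸ hz')

theorem measureReal_neighborhoodEvent_inter_dominatingEvent [Fintype V]
    [DecidableEq V] (p : I) {x : V} {N : Finset V}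
    (hN : N ⊆ Finset.univ.erase x) :
    (SimpleGraph.binomialRandom V p).real (neighborhoodEvent x N ∩ dominatingEvent x N) =
      (p : ℝ) ^ N.card * (1 - p) ^ ((Finset.univ.erase x).card - N.card) *
        (1 - (1 - (p : ℝ)) ^ N.card) ^ (Finset.univ.erase x \ N).card := by
  rw [← measureReal_neighborhoodEvent p hN, ← measureReal_dominatingEvent p x N]
  -- The first event looks only at pairs containing x, the second only at pairs avoiding x.
  refine measureReal_inter_of_determinedOn p (F := {e | x ∈ e}) (F' := {e | x ∉ e})
    (Set.disjoint_left.2 fun e h h' => h' h) ?_ ?_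
  · refine (DeterminedOn.biInter fun z _ => determinedOn_adj_iff x z N).mono ?_
    simp
  · refine (DeterminedOn.biInter fun y _ => (determinedOn_iInter_not_adj y N).compl).mono ?_
    simp only [Set.iUnion_subset_iff, Set.image_subset_iff]
    intro y hy z hz
    have hyx : x ≠ y := (Finset.ne_of_mem_erase (Finset.mem_sdiff.1 hy).1).symm
    have hzx : x ≠ z := (Finset.ne_of_mem_erase (hN hz)).symm
    simp [hyx, hzx]

/-- Revealing the neighborhood of one vertex bounds the probability that any two vertices have two
common neighbors. -/
theorem measureReal_twoCommonNeighbors_le [Fintype V] [Nonempty V] (p : I) (t : ℕ) :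
    (SimpleGraph.binomialRandom V p).real {G | TwoCommonNeighbors G} ≤
      (1 + p : ℝ) ^ (Fintype.card V - 1) / 2 ^ t +
        (1 - (1 - (p : ℝ)) ^ t) ^ (Fintype.card V - 1 - t) := by
  classical
  obtain ⟨x⟩ := ‹Nonempty V›
  have hp0 : (0 : ℝ) ≤ p := p.2.1
  have hp1 : (0 : ℝ) ≤ 1 - p := sub_nonneg.2 p.2.2
  have hp1' : 1 - (p : ℝ) ≤ 1 := by linarith
  set X := (Finset.univ : Finset V).erase x with hX
  have hcard : X.card = Fintype.card V - 1 := Finset.card_erase_of_mem (Finset.mem_univ x)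
  have hsub : {G : SimpleGraph V | TwoCommonNeighbors G} ⊆
      ⋃ N ∈ X.powerset, neighborhoodEvent x N ∩ dominatingEvent x N := by
    intro G hG
    have hNX : G.neighborFinset x ⊆ X := fun z hz =>
      Finset.mem_erase.2 ⟨((G.mem_neighborFinset x z).1 hz).ne', Finset.mem_univ z⟩
    refine Set.mem_biUnion (Finset.mem_powerset.2 hNX) ⟨?_, ?_⟩
    · simp [neighborhoodEvent]
    · simp only [dominatingEvent, Set.mem_iInter, Set.mem_compl_iff, Set.mem_ofPred_eq]
      intro y hy hno
      have hyx : x ≠ y := (Finset.ne_of_mem_erase (Finset.mem_sdiff.1 hy).1).symm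
      obtain ⟨z, hz⟩ := Set.nonempty_of_ncard_ne_zero (by have := hG x y hyx; omega :
        (G.commonNeighbors x y).ncard ≠ 0)
      exact hno z ((G.mem_neighborFinset x z).2 hz.1) hz.2
  have hbase (k : ℕ) : 0 ≤ 1 - (1 - (p : ℝ)) ^ k := sub_nonneg.2 (pow_le_one₀ hp1 hp1')
  have hbase' (k : ℕ) : 1 - (1 - (p : ℝ)) ^ k ≤ 1 := sub_le_self _ (pow_nonneg hp1 k)
  -- The second summand covers |N| ≤ t, by monotonicity of the domination probability; the first
  -- covers |N| ≥ t, where 2^|N| / 2^t ≥ 1.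
  have hterm (N : Finset V) (hN : N ∈ X.powerset) :
      (SimpleGraph.binomialRandom V p).real (neighborhoodEvent x N ∩ dominatingEvent x N) ≤
        (2 * (p : ℝ)) ^ N.card * (1 - p) ^ (X.card - N.card) / 2 ^ t +
        (p : ℝ) ^ N.card * (1 - p) ^ (X.card - N.card) *
          (1 - (1 - (p : ℝ)) ^ t) ^ (Fintype.card V - 1 - t) := by
    rw [measureReal_neighborhoodEvent_inter_dominatingEvent p (Finset.mem_powerset.1 hN),
      Finset.card_sdiff_of_subset (Finset.mem_powerset.1 hN), ← hX, ← hcard]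
    have hw : 0 ≤ (p : ℝ) ^ N.card * (1 - p) ^ (X.card - N.card) := by positivity
    rcases le_total N.card t with h | h
    · refine le_add_of_nonneg_of_le (by positivity) (mul_le_mul_of_nonneg_left ?_ hw)
      calc _ ≤ (1 - (1 - (p : ℝ)) ^ t) ^ (X.card - N.card) :=
            pow_le_pow_left₀ (hbase _)
              (sub_le_sub_left (pow_le_pow_of_le_one hp1 hp1' h) _) _
        _ ≤ _ := pow_le_pow_of_le_one (hbase t) (hbase' t) (by omega)
    · refine le_add_of_le_of_nonneg ?_ (mul_nonneg hw (pow_nonneg (hbase t) _))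
      refine (mul_le_of_le_one_right hw (pow_le_one₀ (hbase _) (hbase' _))).trans ?_
      rw [mul_pow, le_div_iff₀ (by positivity), mul_assoc (2 ^ N.card : ℝ), mul_comm]
      exact mul_le_mul_of_nonneg_right (pow_le_pow_right₀ one_le_two h) hw
  calc _ ≤ (SimpleGraph.binomialRandom V p).real
        (⋃ N ∈ X.powerset, neighborhoodEvent x N ∩ dominatingEvent x N) :=
      measureReal_mono hsub (measure_ne_top _ _)
    _ ≤ ∑ N ∈ X.powerset, (SimpleGraph.binomialRandom V p).real
        (neighborhoodEvent x N ∩ dominatingEvent x N) := measureReal_biUnion_finset_le _ _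
    _ ≤ _ := Finset.sum_le_sum hterm
    _ = _ := by
      -- By the binomial theorem the weights sum to powers of 2p + (1 - p) = 1 + p and of p + (1 -
      -- p) = 1.
      rw [Finset.sum_add_distrib, ← Finset.sum_div, ← Finset.sum_mul,
        Finset.sum_pow_mul_eq_add_pow, Finset.sum_pow_mul_eq_add_pow, hcard]
      congr 2
      · ring
      · simp

end FiniteBounds

/-! ### Asymptotics and the thresholds. -/

section Threshold

open Filter Topology

theorem almostSurely_of_tendsto_compl {p : ℕ → I} {A : ∀ n : ℕ, SimpleGraph (Fin n) → Prop}
    (h : Tendsto (fun n => (SimpleGraph.binomialRandom (Fin n) (p n)).real {G | ¬ A n G})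
      atTop (𝓝 0)) : AlmostSurely p A := by
  have h' : Tendsto (fun n => ENNReal.ofReal
      (1 - (SimpleGraph.binomialRandom (Fin n) (p n)).real {G | ¬ A n G})) atTop (𝓝 1) := by
    simpa using ENNReal.tendsto_ofReal (h.const_sub 1)
  refine h'.congr fun n => ?_
  rw [← probReal_compl_eq_one_sub MeasurableSet.of_discrete, ofReal_measureReal]
  congr 1
  ext G
  simp

/-- The constant 3 gives (n - 3)p² ≥ 9(n - 3)/n · log n ≥ 4 log n once n ≥ 6, so the power is at
most n⁻⁴ and beats n³. -/
theorem pow_three_mul_one_sub_sq_pow_le {n : ℕ} (hn : 6 ≤ n) {p : ℝ} (hp : p ≤ 1)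
    (h : 3 * √(Real.log n / n) ≤ p) : (n : ℝ) ^ 3 * (1 - p ^ 2) ^ (n - 3) ≤ 1 / n := by
  have hn' : (6 : ℝ) ≤ n := by exact_mod_cast hn
  have hn0 : (0 : ℝ) < n := by linarith
  have hlog : 0 ≤ Real.log n := Real.log_nonneg (by linarith)
  have hp0 : 0 ≤ p := le_trans (by positivity) h
  have hsq : 9 * (Real.log n / n) ≤ p ^ 2 := by
    calc 9 * (Real.log n / n) = (3 * √(Real.log n / n)) ^ 2 := by
          rw [mul_pow, Real.sq_sqrt (by positivity)]; norm_num
      _ ≤ p ^ 2 := pow_le_pow_left₀ (by positivity) h 2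
  have hexp : 4 * Real.log n ≤ ((n - 3 : ℕ) : ℝ) * p ^ 2 := by
    rw [Nat.cast_sub (by omega)]
    calc 4 * Real.log n ≤ (9 * (n - 3) / n) * Real.log n := by
          refine mul_le_mul_of_nonneg_right ?_ hlog
          rw [le_div_iff₀ hn0]
          linarith
      _ = (n - 3) * (9 * (Real.log n / n)) := by ring
      _ ≤ _ := by
        push_cast
        exact mul_le_mul_of_nonneg_left hsq (by linarith)
  have hpow : (1 - p ^ 2) ^ (n - 3) ≤ 1 / (n : ℝ) ^ 4 := by
    calc (1 - p ^ 2) ^ (n - 3) ≤ Real.exp (-p ^ 2) ^ (n - 3) :=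
          pow_le_pow_left₀ (by nlinarith) (by linarith [Real.add_one_le_exp (-p ^ 2)]) _
      _ = Real.exp (-(((n - 3 : ℕ) : ℝ) * p ^ 2)) := by rw [← Real.exp_nat_mul]; ring_nf
      _ ≤ Real.exp (-(4 * Real.log n)) := Real.exp_le_exp.2 (by linarith)
      _ = 1 / (n : ℝ) ^ 4 := by
        rw [Real.exp_neg, one_div, ← Real.exp_log (pow_pos hn0 4), Real.log_pow]
        norm_num
  calc (n : ℝ) ^ 3 * (1 - p ^ 2) ^ (n - 3) ≤
        (n : ℝ) ^ 3 * (1 / (n : ℝ) ^ 4) := by gcongr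
    _ = 1 / (n : ℝ) := by field_simp

theorem almostSurely_twoCommonNeighbors {p : ℕ → I}
    (hp : ∀ᶠ n : ℕ in atTop, 3 * √(Real.log n / n) ≤ (p n : ℝ)) :
    AlmostSurely p fun _ G => TwoCommonNeighbors G := by
  refine almostSurely_of_tendsto_compl (squeeze_zero' (.of_forall fun n => measureReal_nonneg) ?_
    (tendsto_one_div_atTop_nhds_zero_nat (𝕜 := ℝ)))
  filter_upwards [hp, eventually_ge_atTop 6] with n hpn hn
  have := measureReal_not_twoCommonNeighbors_le (V := Fin n) (p n) (by simp; omega)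
  rw [Fintype.card_fin] at this
  exact this.trans (pow_three_mul_one_sub_sq_pow_le hn (p n).2.2 hpn)

/-- The factor 3 works because 3 log 2 > 2, so that 2^t ≥ exp(2np) while the numerator is at most
exp(np). -/
theorem one_add_pow_div_two_pow_le {n t : ℕ} {p : ℝ} (hp : 0 ≤ p) (ht : 3 * (n * p) ≤ t) :
    (1 + p) ^ (n - 1) / 2 ^ t ≤ Real.exp (-(n * p)) := by
  have h1 : (1 + p) ^ (n - 1) ≤ Real.exp (n * p) := by
    calc (1 + p) ^ (n - 1) ≤ (1 + p) ^ n := pow_le_pow_right₀ (by linarith) (Nat.sub_le _ _)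
      _ ≤ Real.exp p ^ n :=
        pow_le_pow_left₀ (by linarith) (by linarith [Real.add_one_le_exp p]) _
      _ = _ := (Real.exp_nat_mul _ _).symm
  have h2 : Real.exp (2 * (n * p)) ≤ 2 ^ t := by
    calc Real.exp (2 * (n * p)) ≤ Real.exp (t * Real.log 2) := by
          refine Real.exp_le_exp.2 ?_
          have : 0 ≤ n * p := by positivity
          nlinarith [Real.log_two_gt_d9]
      _ = 2 ^ t := by rw [Real.exp_nat_mul, Real.exp_log two_pos]
  rw [div_le_iff₀ (by positivity)]
  calc (1 + p) ^ (n - 1) ≤ Real.exp (n * p) := h1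
    _ = Real.exp (-(n * p)) * Real.exp (2 * (n * p)) := by rw [← Real.exp_add]; ring_nf
    _ ≤ _ := by gcongr

theorem exp_neg_two_mul_le_one_sub {p : ℝ} (hp : 0 ≤ p) (hp' : p ≤ 1 / 2) :
    Real.exp (-(2 * p)) ≤ 1 - p := by
  rw [Real.exp_neg, inv_le_comm₀ (Real.exp_pos _) (by linarith)]
  refine le_trans ?_ (Real.add_one_le_exp (2 * p))
  rw [inv_le_iff_one_le_mul₀ (by linarith)]
  nlinarith

/-- A vertex is undominated with probability at least exp(-2pt) ≥ n^(-1/2), since 2pt ≤ (3/8) log n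
+ 2p; at least n/4 vertices are tested. -/
theorem one_sub_one_sub_pow_pow_le {n t : ℕ} {p : ℝ} (hp : 0 ≤ p) (hp' : p ≤ 1 / 8)
    (hn : 6 ≤ n) (hlog : 4 ≤ Real.log n) (hsq : 16 * (n * p ^ 2) = Real.log n)
    (ht : (t : ℝ) ≤ 3 * (n * p) + 1) :
    (1 - (1 - p) ^ t) ^ (n - 1 - t) ≤ Real.exp (-(√n / 4)) := by
  have hn' : (6 : ℝ) ≤ n := by exact_mod_cast hn
  have hn0 : (0 : ℝ) < n := by linarith
  have hm : (n : ℝ) / 4 ≤ ((n - 1 - t : ℕ) : ℝ) := by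
    have h : (n : ℝ) ≤ ((n - 1 - t : ℕ) : ℝ) + 1 + t := by
      exact_mod_cast (by omega : n ≤ n - 1 - t + 1 + t)
    nlinarith
  have hsqrt : Real.exp (-(Real.log n / 2)) = (√n)⁻¹ := by
    rw [Real.exp_neg, Real.exp_half, Real.exp_log hn0]
  have hpow : (√n)⁻¹ ≤ (1 - p) ^ t := by
    calc (√n)⁻¹ = Real.exp (-(Real.log n / 2)) := hsqrt.symm
      _ ≤ Real.exp (t * -(2 * p)) := by
        refine Real.exp_le_exp.2 ?_
        nlinarith [mul_le_mul_of_nonneg_right ht hp]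
      _ = Real.exp (-(2 * p)) ^ t := Real.exp_nat_mul _ _
      _ ≤ _ := pow_le_pow_left₀ (Real.exp_nonneg _)
        (exp_neg_two_mul_le_one_sub hp (by linarith)) _
  calc (1 - (1 - p) ^ t) ^ (n - 1 - t) ≤ Real.exp (-(√n)⁻¹) ^ (n - 1 - t) := by
        refine pow_le_pow_left₀ (sub_nonneg.2 (pow_le_one₀ (by linarith) (by linarith))) ?_ _
        linarith [Real.add_one_le_exp (-(√n)⁻¹)]
    _ = Real.exp (-(((n - 1 - t : ℕ) : ℝ) * (√n)⁻¹)) := by rw [← Real.exp_nat_mul]; ring_nf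
    _ ≤ Real.exp (-(n / 4 * (√n)⁻¹)) := by gcongr
    _ = Real.exp (-(√n / 4)) := by
      rw [div_mul_eq_mul_div, ← div_eq_mul_inv, Real.div_sqrt]

theorem tendsto_log_div_atTop : Tendsto (fun n : ℕ => Real.log n / n) atTop (𝓝 0) :=
  Real.isLittleO_log_id_atTop.tendsto_div_nhds_zero.comp tendsto_natCast_atTop_atTop

theorem almostSurely_not_twoCommonNeighbors {p : ℕ → I}
    (hp : ∀ᶠ n : ℕ in atTop, (p n : ℝ) = 1 / 4 * √(Real.log n / n)) :
    AlmostSurely p fun _ G => ¬ TwoCommonNeighbors G := by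
  have hlim : Tendsto (fun n : ℕ => 2 * Real.exp (-(√n / 4))) atTop (𝓝 0) := by
    have : Tendsto (fun n : ℕ => √(n : ℝ) / 4) atTop atTop :=
      (Real.tendsto_sqrt_atTop.comp tendsto_natCast_atTop_atTop).atTop_div_const (by norm_num)
    simpa using (Real.tendsto_exp_neg_atTop_nhds_zero.comp this).const_mul 2
  refine almostSurely_of_tendsto_compl (squeeze_zero' (.of_forall fun n => measureReal_nonneg) ?_
    hlim)
  filter_upwards [hp, eventually_ge_atTop 6,
    (Real.tendsto_log_atTop.comp tendsto_natCast_atTop_atTop).eventually_ge_atTop 4,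
    tendsto_log_div_atTop.eventually_le_const (by norm_num : (0 : ℝ) < 1 / 4)]
    with n hpn hn hlog hsmall
  have : Nonempty (Fin n) := ⟨⟨0, by omega⟩⟩
  have hlog : 4 ≤ Real.log n := hlog
  have hn0 : (0 : ℝ) < n := by exact_mod_cast (by omega : 0 < n)
  have hp8 : (p n : ℝ) ≤ 1 / 8 := by
    rw [hpn]
    have : √(Real.log n / n) ≤ 1 / 2 := Real.sqrt_le_iff.2 ⟨by norm_num, by linarith⟩
    linarith
  have hsq : 16 * (n * (p n : ℝ) ^ 2) = Real.log n := by
    rw [hpn, mul_pow, Real.sq_sqrt (by positivity)]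
    field_simp
    norm_num
  have hnp : √n / 4 ≤ n * (p n : ℝ) := by
    have h : √n ≤ n * √(Real.log n / n) := by
      rw [Real.sqrt_div (by linarith), mul_div_left_comm, Real.div_sqrt]
      exact le_mul_of_one_le_left (by positivity) (Real.one_le_sqrt.2 (by linarith))
    rw [hpn]
    linarith
  have hnp0 : 0 ≤ n * (p n : ℝ) := le_trans (by positivity) hnp
  -- The cutoff t is about three times the mean degree.
  have hbound := measureReal_twoCommonNeighbors_le (V := Fin n) (p n) ⌈3 * (n * (p n : ℝ))⌉₊
  rw [Fintype.card_fin] at hbound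
  have h1 := one_add_pow_div_two_pow_le (p n).2.1 (Nat.le_ceil (3 * (n * (p n : ℝ))))
  have h2 := one_sub_one_sub_pow_pow_le (p n).2.1 hp8 hn hlog hsq
    (Nat.ceil_lt_add_one (by positivity : 0 ≤ 3 * (n * (p n : ℝ)))).le
  have h3 : Real.exp (-(n * (p n : ℝ))) ≤ Real.exp (-(√n / 4)) := Real.exp_le_exp.2 (by linarith)
  simp only [not_not]
  linarith

theorem isSharpThreshold_twoCommonNeighbors :
    IsSharpThreshold (fun n => √(Real.log n / n)) fun _ G => TwoCommonNeighbors G := by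
  have hf (n : ℕ) : 1 / 4 * √(Real.log n / n) ∈ I := by
    have : √(Real.log n / n) ≤ 1 :=
      Real.sqrt_le_one.2 (div_le_one_of_le₀ (Real.log_le_self n.cast_nonneg) n.cast_nonneg)
    exact ⟨by positivity, by linarith⟩
  exact ⟨1 / 4, 3, by norm_num, by norm_num,
    ⟨fun n => ⟨_, hf n⟩, .of_forall fun n => rfl,
      almostSurely_not_twoCommonNeighbors (.of_forall fun n => rfl)⟩,
    fun p hp => almostSurely_twoCommonNeighbors hp⟩

theorem AlmostSurely.congr {p : ℕ → I} {A B : ∀ n : ℕ, SimpleGraph (Fin n) → Prop}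
    (hA : AlmostSurely p A) (h : ∀ᶠ n in atTop, ∀ G, A n G ↔ B n G) : AlmostSurely p B :=
  Tendsto.congr' (h.mono fun n hn => by simp only [hn]) hA

theorem IsSharpThreshold.congr {f : ℕ → ℝ} {A B : ∀ n : ℕ, SimpleGraph (Fin n) → Prop}
    (hA : IsSharpThreshold f A) (h : ∀ᶠ n in atTop, ∀ G, A n G ↔ B n G) :
    IsSharpThreshold f B := by
  obtain ⟨c, C, hc, hC, ⟨p, hp, hpA⟩, hupper⟩ := hA
  exact ⟨c, C, hc, hC, ⟨p, hp, hpA.congr (h.mono fun n hn G => not_congr (hn G))⟩,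
    fun q hq => (hupper q hq).congr h⟩

end Threshold

end RainbowVertexDisconnection

theorem mainTheorem8 :
    RainbowVertexDisconnection.IsSharpThreshold (fun n => Real.sqrt (Real.log n / n))
      (fun n G => G.Connected ∧ RainbowVertexDisconnection.rvd G = n) ∧
    RainbowVertexDisconnection.IsSharpThreshold (fun n => Real.sqrt (Real.log n / n))
      (fun _ G => RainbowVertexDisconnection.TwoCommonNeighbors G) ∧
    ∀ n : ℕ, 2 ≤ n → ∀ G : SimpleGraph (Fin n),
      (RainbowVertexDisconnection.rvd G = n ↔ RainbowVertexDisconnection.TwoCommonNeighbors G) ∧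
      (RainbowVertexDisconnection.TwoCommonNeighbors G → G.Connected) := by
  have hconn {n : ℕ} (hn : 2 ≤ n) {G : SimpleGraph (Fin n)}
      (hG : RainbowVertexDisconnection.TwoCommonNeighbors G) : G.Connected :=
    have : Nonempty (Fin n) := ⟨⟨0, by omega⟩⟩
    hG.connected
  refine ⟨RainbowVertexDisconnection.isSharpThreshold_twoCommonNeighbors.congr ?_,
    RainbowVertexDisconnection.isSharpThreshold_twoCommonNeighbors,
    fun n hn G => ⟨RainbowVertexDisconnection.rvd_eq_iff hn G, hconn hn⟩⟩
  -- Small orders must be dropped: for n = 0 the common-neighbor condition is vacuous, but the graph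
  -- is not connected.
  filter_upwards [Filter.eventually_ge_atTop 2] with n hn G
  exact ⟨fun hG => ⟨hconn hn hG, (RainbowVertexDisconnection.rvd_eq_iff hn G).2 hG⟩,
    fun hG => (RainbowVertexDisconnection.rvd_eq_iff hn G).1 hG.2⟩
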